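/- Let $N\ge 1$, let $\mathbf R\in\mathbb C^{N\times N}$ be a nonzero positive semidefinite Hermitian matrix of rank $r_{\mathbf R}$, and let $\mathbf h\sim\mathcal{CN}(\mathbf 0,\mathbf R)$ be a circularly symmetric complex Gaussian random vector, i.e. $\mathbf h$ has the law of $\mathbf R^{1/2}\tilde{\mathbf h}$, where $\tilde{\mathbf h}$ has independent entries whose real and imaginary parts are independent $\mathcal N(0,1/2)$. Let $\sigma>0$, and for $p>0$ let $$\bar{\mathcal C}(p)=\mathbb E\Big[\log_2\Big(1+\frac{p}{\sigma^2}\|\mathbf h\|^2\Big)\Big]$$ be the ergodic channel capacity of the Rayleigh fading channel. Let $\lambda_1,\dots,\lambda_{r_{\mathbf R}}$ be the positive eigenvalues of $\mathbf R$, counted with multiplicity, let $\lambda_{\min}=\min_i\lambda_i$, let $\psi_0=1$ and $$\psi_{k+1}=\sum_{i=1}^{k+1}\Big[\sum_{j=1}^{r_{\mathbf R}}\Big(1-\frac{\lambda_{\min}}{\lambda_j}\Big)^{i}\Big]\frac{\psi_{k+1-i}}{k+1}\qquad(k\ge 0),$$ and let $\psi(x)=\frac{\mathrm d}{\mathrm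 dx}\ln\Gamma(x)$ be the digamma function. Then $\bar{\mathcal C}(p)$ behaves at high SNR as $\mathcal S_\infty(\log_2 p-\mathcal L_\infty)$, that is, $$\lim_{p\to\infty}\frac{\bar{\mathcal C}(p)}{\log_2 p}=\mathcal S_\infty,\qquad \lim_{p\to\infty}\Big(\bar{\mathcal C}(p)-\mathcal S_\infty\big(\log_2 p-\mathcal L_\infty\big)\Big)=0,$$ with high-SNR slope $\mathcal S_\infty=1$ and high-SNR power offset $$\mathcal L_\infty=-\mathbb E\Big[\log_2\frac{\|\mathbf h\|^2}{\sigma^2}\Big]=\log_2\sigma^2-\frac{\lambda_{\min}^{r_{\mathbf R}}}{\prod_{i=1}^{r_{\mathbf R}}\lambda_i}\sum_{k=0}^{\infty}\frac{\psi_k\big(\psi(r_{\mathbf R}+k)+\ln\lambda_{\min}\big)}{\ln 2},$$ where both expectations are those of integrable random variables and the series converges absolutely. -/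

import Mathlib

open MeasureTheory ProbabilityTheory Filter Topology
open scoped MatrixOrder ComplexOrder

noncomputable section

/-- The law `𝒞𝒩(0, 1)` on `ℂ`: independent real and imaginary parts, each with law
`𝒩(0, 1/2)`. -/
def stdComplexGaussian : Measure ℂ :=
  ((gaussianReal 0 (1 / 2)).prod (gaussianReal 0 (1 / 2))).map
    Complex.measurableEquivRealProd.symm

/-- The law `𝒞𝒩(0, I)` on `ℂ^N`: the `N` entries are independent with law `𝒞𝒩(0, 1)`. -/
def stdComplexGaussianVec (N : ℕ) : Measure (EuclideanSpace ℂ (Fin N)) :=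
  (Measure.pi (fun _ : Fin N => stdComplexGaussian)).map (WithLp.toLp 2)

/-- The law `𝒞𝒩(m, R)` on `ℂ^N`, i.e. the law of `m + R^{1/2} g` with `g ∼ 𝒞𝒩(0, I)`, where
`R^{1/2}` is the positive semidefinite square root of the positive semidefinite matrix `R`. -/
def complexGaussian {N : ℕ} (m : EuclideanSpace ℂ (Fin N)) (R : Matrix (Fin N) (Fin N) ℂ) :
    Measure (EuclideanSpace ℂ (Fin N)) :=
  (stdComplexGaussianVec N).map
    (fun g => m + Matrix.toEuclideanCLM (𝕜 := ℂ) (CFC.sqrt R) g)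

/-- Received signal-to-noise ratio `γ = (p / σ²) ‖h‖²` at transmit power `p` and noise
power `σ²`, for the channel vector `h`. -/
def receivedSNR {N : ℕ} (σ p : ℝ) (h : EuclideanSpace ℂ (Fin N)) : ℝ :=
  p / σ ^ 2 * ‖h‖ ^ 2

/-- Ergodic channel capacity `E[log₂(1 + γ)]` of the random channel `h`, as a function of `p`. -/
def ergodicCapacity {N : ℕ} {Ω : Type*} [MeasurableSpace Ω] (P : Measure Ω)
    (h : Ω → EuclideanSpace ℂ (Fin N)) (σ p : ℝ) : ℝ :=
  ∫ ω, Real.logb 2 (1 + receivedSNR σ p (h ω)) ∂P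

/-- `C(p)` behaves as `S (log₂ p - L)` for large `p`, with slope `S` and power offset `L`:
`C(p) / log₂ p → S` and `C(p) - S (log₂ p - L) → 0`. -/
def HasHighSNRExpansion (C : ℝ → ℝ) (S L : ℝ) : Prop :=
  Tendsto (fun p => C p / Real.logb 2 p) atTop (𝓝 S) ∧
  Tendsto (fun p => C p - S * (Real.logb 2 p - L)) atTop (𝓝 0)

/-- The real digamma function `d/dx ln Γ(x)`. -/
def realDigamma (x : ℝ) : ℝ :=
  deriv (fun t : ℝ => Real.log (Real.Gamma t)) x

namespace Matrix.PosSemidef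

variable {N : ℕ} {R : Matrix (Fin N) (Fin N) ℂ}

/-- The indices of the positive eigenvalues (with multiplicity). -/
def PosIdx (hR : R.PosSemidef) : Finset (Fin N) :=
  Finset.univ.filter (fun i => 0 < hR.isHermitian.eigenvalues i)

/-- The smallest positive eigenvalue (of a nonzero matrix). -/
def lambdaMin (hR : R.PosSemidef) : ℝ :=
  ⨅ i : hR.PosIdx, hR.isHermitian.eigenvalues i

/-- The product of the positive eigenvalues, with multiplicity. -/
def posEigProd (hR : R.PosSemidef) : ℝ :=
  ∏ i ∈ hR.PosIdx, hR.isHermitian.eigenvalues i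

/-- The coefficients `ψ_k`: `ψ_0 = 1` and
`ψ_{k+1} = ∑_{i=1}^{k+1} [∑_j (1 - λ_min / λ_j)^i] ψ_{k+1-i} / (k+1)`, the inner sum being over
the positive eigenvalues. The summation index below is `m = i - 1 ∈ {0, …, k}`. -/
def gainCoeff (hR : R.PosSemidef) : ℕ → ℝ
  | 0 => 1
  | k + 1 => ∑ m : Fin (k + 1),
      (∑ j ∈ hR.PosIdx, (1 - hR.lambdaMin / hR.isHermitian.eigenvalues j) ^ ((m : ℕ) + 1)) *
        (gainCoeff hR (k - m) / ((k : ℝ) + 1))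
  termination_by k => k
  decreasing_by omega

end Matrix.PosSemidef

end

/-! In an eigenbasis of `R`, unitary invariance of the standard complex Gaussian turns `‖h‖²` into
`∑ λ_j |g_j|²` with independent `g_j`, so its characteristic function is `∏ (1 - i t λ_j)⁻¹` over
the positive eigenvalues. Put `β = λ_min` and `z = (1 - i t β)⁻¹`. Each factor equals `(β/λ_j) z /
(1 - (1 - β/λ_j) z)`, with `0 ≤ 1 - β/λ_j < 1` and `‖z‖ ≤ 1`. The product of these geometric series
has coefficients `ψ_k`, because comparing coefficients in its logarithmic derivative gives their
recursion. As `z` is the characteristic function of the exponential law of mean `β`, uniqueness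
shows that `‖h‖²` is a mixture of Gamma laws of shapes `rank + k` and scale `β`
(`map_norm_sq_complexGaussian`). Under a Gamma law of integer shape `n` and scale `β` the mean of
`log` is `ψ(n) + ln β` (`integral_log_erlang`). The mean of `|log|` grows at most linearly in the
shape, and `∑ k ψ_k` converges, so the mixture can be integrated term by term. The capacity limit is
dominated convergence: `log₂(1 + pY) - log₂ p - log₂ Y = log₂(1 + 1/(pY))` decreases to `0` in `p`
(`tendsto_integral_logb_one_add_mul_sub`). -/

/-! ### Products of geometric series and the recursion for `ψ_k`. -/

section GeometricProduct

variable {ι : Type*}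

/-- The product of the geometric power series `1 / (1 - a j X)`, `j ∈ s`. -/
noncomputable def geomProd (s : Finset ι) (a : ι → ℝ) : PowerSeries ℝ :=
  ∏ j ∈ s, PowerSeries.mk fun n => a j ^ n

lemma derivative_mk_pow (x : ℝ) :
    PowerSeries.derivative ℝ (PowerSeries.mk fun n => x ^ n) =
      PowerSeries.mk (fun n => x ^ n) * PowerSeries.mk fun n => x ^ (n + 1) := by
  ext n
  rw [PowerSeries.coeff_derivative, PowerSeries.coeff_mul]
  simp only [PowerSeries.coeff_mk]
  rw [Finset.sum_congr rfl (g := fun _ => x ^ (n + 1))]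
  · simp [mul_comm]
  · intro p hp
    rw [← pow_add, ← Finset.HasAntidiagonal.mem_antidiagonal.1 hp, add_assoc]

/-- Logarithmic derivative: each factor contributes `a j / (1 - a j X)`, and these add up to the
generating series of the power sums. -/
lemma derivative_geomProd (s : Finset ι) (a : ι → ℝ) :
    PowerSeries.derivative ℝ (geomProd s a) =
      (PowerSeries.mk fun n => ∑ j ∈ s, a j ^ (n + 1)) * geomProd s a := by
  classical
  induction s using Finset.induction_on with
  | empty =>
    have : (PowerSeries.mk fun n => ∑ j ∈ (∅ : Finset ι), a j ^ (n + 1)) = 0 := by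
      ext n; simp
    rw [this]
    simp [geomProd]
  | insert i s hi ih =>
    have h1 : geomProd (insert i s) a = (PowerSeries.mk fun n => a i ^ n) * geomProd s a := by
      simp [geomProd, Finset.prod_insert hi]
    have h2 : (PowerSeries.mk fun n => ∑ j ∈ insert i s, a j ^ (n + 1)) =
        (PowerSeries.mk fun n => a i ^ (n + 1)) +
          PowerSeries.mk fun n => ∑ j ∈ s, a j ^ (n + 1) := by
      ext n; simp [Finset.sum_insert hi]
    rw [h1, h2, Derivation.leibniz, ih, derivative_mk_pow]
    simp only [smul_eq_mul]
    ring

lemma coeff_zero_geomProd (s : Finset ι) (a : ι → ℝ) :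
    PowerSeries.coeff 0 (geomProd s a) = 1 := by
  simp [geomProd, map_prod, ← PowerSeries.coeff_zero_eq_constantCoeff_apply]

lemma coeff_succ_geomProd (s : Finset ι) (a : ι → ℝ) (k : ℕ) :
    PowerSeries.coeff (k + 1) (geomProd s a) =
      ∑ m ∈ Finset.range (k + 1), (∑ j ∈ s, a j ^ (m + 1)) *
        (PowerSeries.coeff (k - m) (geomProd s a) / ((k : ℝ) + 1)) := by
  have h := congrArg (PowerSeries.coeff k) (derivative_geomProd s a)
  rw [PowerSeries.coeff_derivative, PowerSeries.coeff_mul,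
    Finset.Nat.sum_antidiagonal_eq_sum_range_succ_mk] at h
  simp only [PowerSeries.coeff_mk] at h
  have hk : (k : ℝ) + 1 ≠ 0 := by positivity
  simp only [← mul_div_assoc, ← Finset.sum_div]
  rw [eq_div_iff hk, h]

lemma coeff_geomProd_nonneg (s : Finset ι) (a : ι → ℝ) (ha : ∀ j ∈ s, 0 ≤ a j) (k : ℕ) :
    0 ≤ PowerSeries.coeff k (geomProd s a) := by
  induction k using Nat.strong_induction_on with
  | _ k ih =>
    cases k with
    | zero => simp [coeff_zero_geomProd]
    | succ k =>
      rw [coeff_succ_geomProd]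
      refine Finset.sum_nonneg fun m _ => mul_nonneg
        (Finset.sum_nonneg fun j hj => pow_nonneg (ha j hj) _)
        (div_nonneg (ih _ (by omega)) (by positivity))

/-- Induction on the factors by Cauchy products. Absolute summability is carried along because the
Cauchy product theorem needs it at each step. -/
lemma summable_norm_and_hasSum_geomProd (s : Finset ι) (a : ι → ℝ) (z : ℂ)
    (hz : ∀ j ∈ s, ‖(a j : ℂ) * z‖ < 1) :
    Summable (fun k : ℕ => ‖((PowerSeries.coeff k (geomProd s a) : ℝ) : ℂ) * z ^ k‖) ∧
      HasSum (fun k : ℕ => ((PowerSeries.coeff k (geomProd s a) : ℝ) : ℂ) * z ^ k)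
        (∏ j ∈ s, (1 - (a j : ℂ) * z)⁻¹) := by
  classical
  induction s using Finset.induction_on with
  | empty =>
    have h0 : ∀ k : ℕ, k ≠ 0 →
        ((PowerSeries.coeff k (geomProd (∅ : Finset ι) a) : ℝ) : ℂ) * z ^ k = 0 := by
      intro k hk
      simp [geomProd, PowerSeries.coeff_one, hk]
    constructor
    · refine summable_of_ne_finset_zero (s := {0}) fun k hk => ?_
      rw [h0 k (by simpa using hk), norm_zero]
    · convert! hasSum_single 0 h0 using 1
      simp [geomProd]
  | insert i s hi ih =>
    obtain ⟨h1, h2⟩ := ih fun j hj => hz j (Finset.mem_insert_of_mem hj)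
    have hi1 : ‖(a i : ℂ) * z‖ < 1 := hz i (Finset.mem_insert_self _ _)
    have g1 : Summable fun k : ℕ => ‖((a i : ℂ) * z) ^ k‖ := by
      simpa [norm_pow] using summable_geometric_of_lt_one (norm_nonneg _) hi1
    have key : (fun k : ℕ => ((PowerSeries.coeff k (geomProd (insert i s) a) : ℝ) : ℂ) * z ^ k) =
        fun k => ∑ p ∈ Finset.HasAntidiagonal.antidiagonal k, ((a i : ℂ) * z) ^ p.1 *
          (((PowerSeries.coeff p.2 (geomProd s a) : ℝ) : ℂ) * z ^ p.2) := by
      funext k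
      have : geomProd (insert i s) a = (PowerSeries.mk fun n => a i ^ n) * geomProd s a := by
        simp [geomProd, Finset.prod_insert hi]
      rw [this, PowerSeries.coeff_mul, Complex.ofReal_sum, Finset.sum_mul]
      refine Finset.sum_congr rfl fun p hp => ?_
      rw [← Finset.HasAntidiagonal.mem_antidiagonal.1 hp, pow_add]
      simp only [PowerSeries.coeff_mk]
      push_cast
      ring
    have hs := summable_norm_sum_mul_antidiagonal_of_summable_norm g1 h1
    refine ⟨?_, ?_⟩
    · refine hs.congr fun k => ?_
      rw [congrFun key k]
    · rw [key, Finset.prod_insert hi, ← tsum_geometric_of_norm_lt_one hi1, ← h2.tsum_eq,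
        tsum_mul_tsum_eq_tsum_sum_antidiagonal_of_summable_norm g1 h1]
      exact hs.of_norm.hasSum

lemma summable_coeff_geomProd_mul_pow (s : Finset ι) (a : ι → ℝ) (ha : ∀ j ∈ s, 0 ≤ a j) {x : ℝ}
    (hx : 0 ≤ x) (hax : ∀ j ∈ s, a j * x < 1) :
    Summable fun k : ℕ => PowerSeries.coeff k (geomProd s a) * x ^ k := by
  have := (summable_norm_and_hasSum_geomProd s a (x : ℂ) (by
    intro j hj
    rw [← Complex.ofReal_mul, Complex.norm_real, Real.norm_of_nonneg (mul_nonneg (ha j hj) hx)]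
    exact hax j hj)).1
  refine this.congr fun k => ?_
  rw [← Complex.ofReal_pow, ← Complex.ofReal_mul, Complex.norm_real, Real.norm_of_nonneg]
  exact mul_nonneg (coeff_geomProd_nonneg s a ha k) (pow_nonneg hx k)

/-- The radius of convergence exceeds 1: some `x > 1` still satisfies `a j * x < 1` for the finitely
many `j`. Bernoulli's inequality `k (x - 1) ≤ x ^ k` then absorbs the factor `k`. -/
lemma summable_coeff_geomProd_mul_nat (s : Finset ι) (a : ι → ℝ)
    (ha : ∀ j ∈ s, 0 ≤ a j ∧ a j < 1) :
    Summable fun k : ℕ => PowerSeries.coeff k (geomProd s a) * (k : ℝ) := by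
  obtain ⟨x, hx1, hx⟩ : ∃ x : ℝ, 1 < x ∧ ∀ j ∈ s, a j * x < 1 := by
    have : ∀ᶠ x : ℝ in 𝓝[>] 1, ∀ j ∈ s, a j * x < 1 := by
      rw [Filter.eventually_all_finset]
      intro j hj
      refine nhdsWithin_le_nhds ?_
      have hc : ContinuousAt (fun x : ℝ => a j * x) 1 := by fun_prop
      exact hc.eventually_lt_const (by simpa using (ha j hj).2)
    obtain ⟨x, h1, h2⟩ := (this.and self_mem_nhdsWithin).exists
    exact ⟨x, h2, h1⟩
  have hs := (summable_coeff_geomProd_mul_pow s a (fun j hj => (ha j hj).1)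
    (zero_le_one.trans hx1.le) hx).div_const (x - 1)
  have hx0 : 0 < x - 1 := sub_pos.2 hx1
  have hc := coeff_geomProd_nonneg s a fun j hj => (ha j hj).1
  refine Summable.of_nonneg_of_le (fun k => mul_nonneg (hc k) k.cast_nonneg) (fun k => ?_) hs
  rw [mul_div_assoc]
  refine mul_le_mul_of_nonneg_left ?_ (hc k)
  rw [le_div_iff₀ hx0]
  have := one_add_mul_le_pow (a := x - 1) (by linarith) k
  rw [add_sub_cancel] at this
  linarith

lemma summable_coeff_geomProd (s : Finset ι) (a : ι → ℝ) (ha : ∀ j ∈ s, 0 ≤ a j ∧ a j < 1) :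
    Summable fun k : ℕ => PowerSeries.coeff k (geomProd s a) := by
  simpa using summable_coeff_geomProd_mul_pow s a (fun j hj => (ha j hj).1) zero_le_one
    (fun j hj => by simpa using (ha j hj).2)

end GeometricProduct

lemma Matrix.PosSemidef.gainCoeff_eq_coeff {N : ℕ} {R : Matrix (Fin N) (Fin N) ℂ}
    (hR : R.PosSemidef) (k : ℕ) :
    hR.gainCoeff k = PowerSeries.coeff k
      (geomProd hR.PosIdx fun j => 1 - hR.lambdaMin / hR.isHermitian.eigenvalues j) := by
  induction k using Nat.strong_induction_on with
  | _ k ih =>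
    cases k with
    | zero => rw [coeff_zero_geomProd, Matrix.PosSemidef.gainCoeff]
    | succ k =>
      rw [coeff_succ_geomProd, Matrix.PosSemidef.gainCoeff, Finset.sum_range]
      refine Finset.sum_congr rfl fun m _ => ?_
      rw [ih _ (by omega)]

/-! ### Gamma laws of integer shape: transforms and logarithmic moments. -/

section Erlang

open Set

lemma integrableOn_pow_mul_exp_neg_mul (n : ℕ) {r : ℝ} (hr : 0 < r) :
    IntegrableOn (fun x : ℝ => x ^ n * Real.exp (-(r * x))) (Ioi 0) := by
  have := integrableOn_rpow_mul_exp_neg_mul_rpow (p := 1) (s := n) (b := r)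
    (by have : (0 : ℝ) ≤ n := n.cast_nonneg
        linarith) one_pos hr
  simpa [Real.rpow_natCast] using this

lemma integrableOn_pow_mul_cexp_neg_mul (n : ℕ) {b : ℂ} (hb : 0 < b.re) :
    IntegrableOn (fun x : ℝ => (x : ℂ) ^ n * Complex.exp (-(b * x))) (Ioi 0) := by
  refine (integrableOn_pow_mul_exp_neg_mul n hb).congr' (by fun_prop) ?_
  refine (ae_restrict_iff' measurableSet_Ioi).2 (ae_of_all _ fun x (hx : 0 < x) => ?_)
  simp [Complex.norm_exp, abs_of_pos hx]

/-- Integration by parts on `x ^ (n + 1) * exp (-b x)`. The rate is complex so that `b = r - i t`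
yields characteristic functions. -/
lemma integral_pow_mul_cexp_neg_mul_Ioi (n : ℕ) {b : ℂ} (hb : 0 < b.re) :
    ∫ x in Ioi (0 : ℝ), (x : ℂ) ^ n * Complex.exp (-(b * x)) =
      (n.factorial : ℂ) / b ^ (n + 1) := by
  have hb0 : b ≠ 0 := by rintro rfl; simp at hb
  induction n with
  | zero =>
    have := integral_exp_mul_complex_Ioi (a := -b) (by simpa using hb) 0
    simpa using this
  | succ n ih =>
    have hd : ∀ x : ℝ, HasDerivAt (fun x : ℝ => (x : ℂ) ^ (n + 1) * Complex.exp (-(b * x)))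
        (((n : ℂ) + 1) * ((x : ℂ) ^ n * Complex.exp (-(b * x))) -
          b * ((x : ℂ) ^ (n + 1) * Complex.exp (-(b * x)))) x := by
      intro x
      have h1 : HasDerivAt (fun z : ℂ => z ^ (n + 1) * Complex.exp (-(b * z)))
          (((n : ℂ) + 1) * ((x : ℂ) ^ n * Complex.exp (-(b * x))) -
            b * ((x : ℂ) ^ (n + 1) * Complex.exp (-(b * x)))) (x : ℂ) := by
        convert! (hasDerivAt_pow (n + 1) (x : ℂ)).mul
          (((hasDerivAt_id (x : ℂ)).const_mul b).neg.cexp) using 1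
        simp only [id, Nat.add_sub_cancel, Pi.neg_apply]
        push_cast
        ring
      exact h1.comp_ofReal
    have ht : Tendsto (fun x : ℝ => (x : ℂ) ^ (n + 1) * Complex.exp (-(b * x))) atTop (𝓝 0) := by
      rw [tendsto_zero_iff_norm_tendsto_zero]
      have := tendsto_rpow_mul_exp_neg_mul_atTop_nhds_zero ((n + 1 : ℕ) : ℝ) b.re hb
      refine this.congr' ?_
      filter_upwards [eventually_ge_atTop 0] with x hx
      simp [Complex.norm_exp, abs_of_nonneg hx, ← Real.rpow_natCast]
    have hi1 := (integrableOn_pow_mul_cexp_neg_mul n hb).const_mul ((n : ℂ) + 1)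
    have hi2 := (integrableOn_pow_mul_cexp_neg_mul (n + 1) hb).const_mul b
    have key := integral_Ioi_of_hasDerivAt_of_tendsto' (a := (0 : ℝ)) (fun x _ => hd x)
      (hi1.sub hi2) ht
    rw [integral_sub hi1 hi2, integral_const_mul, integral_const_mul, ih] at key
    simp only [Complex.ofReal_zero, ne_eq, Nat.add_eq_zero_iff, one_ne_zero, and_false,
      not_false_eq_true, zero_pow, zero_mul, sub_zero] at key
    rw [Nat.factorial_succ, eq_div_iff (pow_ne_zero _ hb0)]
    have h2 := (sub_eq_zero.1 key).symm
    rw [mul_div_assoc', eq_div_iff (pow_ne_zero _ hb0)] at h2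
    push_cast
    rw [← h2]
    ring

lemma integral_pow_mul_exp_neg_mul_Ioi (n : ℕ) {r : ℝ} (hr : 0 < r) :
    ∫ x in Ioi (0 : ℝ), x ^ n * Real.exp (-(r * x)) = (n.factorial : ℝ) / r ^ (n + 1) := by
  have h := integral_pow_mul_cexp_neg_mul_Ioi n (b := r) (by simpa using hr)
  have h2 : ∀ x : ℝ, (x : ℂ) ^ n * Complex.exp (-((r : ℂ) * x)) =
      ((x ^ n * Real.exp (-(r * x)) : ℝ) : ℂ) := fun x => by push_cast; rfl
  simp_rw [h2] at h
  rw [integral_complex_ofReal] at h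
  exact_mod_cast h

/-- The density of the Gamma distribution of integer shape `n + 1` and rate `r` on `(0, ∞)`. -/
noncomputable def erlangPDF (n : ℕ) (r x : ℝ) : ℝ :=
  r ^ (n + 1) / n.factorial * (x ^ n * Real.exp (-(r * x)))

/-- The Gamma distribution of integer shape `n + 1` and rate `r`. -/
noncomputable def erlang (n : ℕ) (r : ℝ) : Measure ℝ :=
  (volume.restrict (Ioi 0)).withDensity fun x => ENNReal.ofReal (erlangPDF n r x)

lemma measurable_erlangPDF (n : ℕ) (r : ℝ) : Measurable (erlangPDF n r) := by
  unfold erlangPDF; fun_prop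

lemma erlangPDF_nonneg (n : ℕ) {r x : ℝ} (hr : 0 < r) (hx : 0 < x) : 0 ≤ erlangPDF n r x := by
  unfold erlangPDF; positivity

lemma integral_erlang {E : Type*} [NormedAddCommGroup E] [NormedSpace ℝ E] (n : ℕ) {r : ℝ}
    (hr : 0 < r) (f : ℝ → E) :
    ∫ x, f x ∂erlang n r = ∫ x in Ioi (0 : ℝ), erlangPDF n r x • f x := by
  rw [erlang, integral_withDensity_eq_integral_toReal_smul
    (measurable_erlangPDF n r).ennreal_ofReal (ae_of_all _ fun _ => ENNReal.ofReal_lt_top)]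
  refine setIntegral_congr_fun measurableSet_Ioi fun x (hx : 0 < x) => ?_
  simp only [ENNReal.toReal_ofReal (erlangPDF_nonneg n hr hx)]

lemma integrable_erlang_iff (n : ℕ) {r : ℝ} (hr : 0 < r) (f : ℝ → ℝ) :
    Integrable f (erlang n r) ↔ IntegrableOn (fun x => erlangPDF n r x * f x) (Ioi 0) := by
  rw [erlang, integrable_withDensity_iff (measurable_erlangPDF n r).ennreal_ofReal
    (ae_of_all _ fun _ => ENNReal.ofReal_lt_top)]
  refine integrable_congr ?_
  refine (ae_restrict_iff' measurableSet_Ioi).2 (ae_of_all _ fun x (hx : 0 < x) => ?_)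
  simp only [ENNReal.toReal_ofReal (erlangPDF_nonneg n hr hx), mul_comm]

lemma isProbabilityMeasure_erlang (n : ℕ) {r : ℝ} (hr : 0 < r) :
    IsProbabilityMeasure (erlang n r) := by
  constructor
  rw [erlang, withDensity_apply _ MeasurableSet.univ, Measure.restrict_univ,
    ← ofReal_integral_eq_lintegral_ofReal]
  · unfold erlangPDF
    rw [integral_const_mul, integral_pow_mul_exp_neg_mul_Ioi n hr]
    have : (n.factorial : ℝ) ≠ 0 := by positivity
    rw [div_mul_div_cancel₀ this, div_self (by positivity), ENNReal.ofReal_one]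
  · exact (integrableOn_pow_mul_exp_neg_mul n hr).const_mul _
  · exact (ae_restrict_iff' measurableSet_Ioi).2
      (ae_of_all _ fun x (hx : 0 < x) => erlangPDF_nonneg n hr hx)

lemma charFun_erlang (n : ℕ) {r : ℝ} (hr : 0 < r) (t : ℝ) :
    charFun (erlang n r) t = ((r : ℂ) / (r - t * Complex.I)) ^ (n + 1) := by
  have hb : 0 < ((r : ℂ) - t * Complex.I).re := by simpa using hr
  have hfac : (n.factorial : ℂ) ≠ 0 := by exact_mod_cast n.factorial_ne_zero
  rw [charFun_apply_real, integral_erlang n hr]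
  have : ∀ x : ℝ, erlangPDF n r x • Complex.exp (t * x * Complex.I) =
      ((r : ℂ) ^ (n + 1) / n.factorial) *
        ((x : ℂ) ^ n * Complex.exp (-((r - t * Complex.I) * x))) := by
    intro x
    rw [erlangPDF, Complex.real_smul]
    push_cast
    rw [show -(((r : ℂ) - t * Complex.I) * x) = -(r * x) + t * x * Complex.I by ring,
      Complex.exp_add]
    ring
  simp_rw [this]
  rw [integral_const_mul, integral_pow_mul_cexp_neg_mul_Ioi n hb, div_pow,
    div_mul_div_cancel₀ hfac]

lemma integrable_id_erlang (n : ℕ) {r : ℝ} (hr : 0 < r) :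
    Integrable (fun x : ℝ => x) (erlang n r) := by
  rw [integrable_erlang_iff n hr]
  refine ((integrableOn_pow_mul_exp_neg_mul (n + 1) hr).const_mul
    (r ^ (n + 1) / n.factorial)).congr (ae_of_all _ fun x => ?_)
  simp only [erlangPDF]
  ring

lemma integral_id_erlang (n : ℕ) {r : ℝ} (hr : 0 < r) :
    ∫ x, x ∂erlang n r = ((n : ℝ) + 1) / r := by
  rw [integral_erlang n hr]
  have : ∀ x : ℝ, erlangPDF n r x • x =
      (r ^ (n + 1) / n.factorial) * (x ^ (n + 1) * Real.exp (-(r * x))) := by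
    intro x; simp only [erlangPDF, smul_eq_mul]; ring
  simp_rw [this]
  rw [integral_const_mul, integral_pow_mul_exp_neg_mul_Ioi _ hr, Nat.factorial_succ]
  have h1 : (n.factorial : ℝ) ≠ 0 := by positivity
  push_cast
  field_simp
  ring

lemma erlangPDF_mul_rpow_neg_half (n : ℕ) {r x : ℝ} (hx : 0 < x) :
    erlangPDF n r x * x ^ (-(1 / 2) : ℝ) =
      (r ^ (n + 1) / n.factorial) *
        (x ^ (((n : ℝ) + 1 / 2) - 1) * Real.exp (-(r * x))) := by
  have : x ^ (((n : ℝ) + 1 / 2) - 1) = x ^ n * x ^ (-(1 / 2) : ℝ) := by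
    rw [← Real.rpow_natCast, ← Real.rpow_add hx]
    congr 1
    ring
  rw [this, erlangPDF]
  ring

lemma integrable_rpow_neg_half_erlang (n : ℕ) {r : ℝ} (hr : 0 < r) :
    Integrable (fun x : ℝ => x ^ (-(1 / 2) : ℝ)) (erlang n r) := by
  rw [integrable_erlang_iff n hr]
  have hn : (0 : ℝ) ≤ n := n.cast_nonneg
  have := (integrableOn_rpow_mul_exp_neg_mul_rpow (p := 1) (s := (n : ℝ) + 1 / 2 - 1) (b := r)
    (by linarith) one_pos hr).const_mul (r ^ (n + 1) / n.factorial)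
  refine this.congr ((ae_restrict_iff' measurableSet_Ioi).2
    (ae_of_all _ fun x (hx : 0 < x) => ?_))
  simp only [erlangPDF_mul_rpow_neg_half n hx, Real.rpow_one, neg_mul]

/-- Crude, but it bounds the moment of order `-1/2` of `erlang n r` uniformly in `n`. The constant 2
comes from the base case `√π ≤ 2`. -/
lemma Gamma_nat_add_half_le (n : ℕ) : Real.Gamma ((n : ℝ) + 1 / 2) ≤ 2 * n.factorial := by
  induction n with
  | zero =>
    rw [Nat.cast_zero, zero_add, Real.Gamma_one_half_eq, Nat.factorial_zero, Nat.cast_one, mul_one,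
      Real.sqrt_le_left (by norm_num)]
    linarith [Real.pi_le_four]
  | succ n ih =>
    have hn : (0 : ℝ) ≤ n := n.cast_nonneg
    have h1 : ((n + 1 : ℕ) : ℝ) + 1 / 2 = ((n : ℝ) + 1 / 2) + 1 := by push_cast; ring
    rw [h1, Real.Gamma_add_one (by positivity), Nat.factorial_succ]
    push_cast
    have hf : (0 : ℝ) ≤ n.factorial := by positivity
    nlinarith [mul_le_mul_of_nonneg_left ih (by positivity : (0 : ℝ) ≤ (n : ℝ) + 1 / 2)]

lemma integral_rpow_neg_half_erlang_le (n : ℕ) {r : ℝ} (hr : 0 < r) :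
    ∫ x, x ^ (-(1 / 2) : ℝ) ∂erlang n r ≤ 2 * r ^ (1 / 2 : ℝ) := by
  have hn : (0 : ℝ) < (n : ℝ) + 1 / 2 := by positivity
  rw [integral_erlang n hr]
  simp only [smul_eq_mul]
  rw [setIntegral_congr_fun measurableSet_Ioi
    (fun x (hx : 0 < x) => erlangPDF_mul_rpow_neg_half (r := r) n hx), integral_const_mul,
    Real.integral_rpow_mul_exp_neg_mul_Ioi hn hr]
  have h1 : r ^ (n + 1) * (1 / r) ^ ((n : ℝ) + 1 / 2) = r ^ (1 / 2 : ℝ) := by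
    rw [one_div r, Real.inv_rpow hr.le, ← Real.rpow_neg hr.le, ← Real.rpow_natCast,
      ← Real.rpow_add hr]
    congr 1
    push_cast
    ring
  have hf : (0 : ℝ) < n.factorial := by positivity
  calc r ^ (n + 1) / n.factorial * ((1 / r) ^ ((n : ℝ) + 1 / 2) * Real.Gamma ((n : ℝ) + 1 / 2))
      = (r ^ (n + 1) * (1 / r) ^ ((n : ℝ) + 1 / 2)) *
          (Real.Gamma ((n : ℝ) + 1 / 2) / n.factorial) := by ring
    _ = r ^ (1 / 2 : ℝ) * (Real.Gamma ((n : ℝ) + 1 / 2) / n.factorial) := by rw [h1]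
    _ ≤ r ^ (1 / 2 : ℝ) * 2 := by
        refine mul_le_mul_of_nonneg_left ?_ (by positivity)
        rw [div_le_iff₀ hf]
        exact Gamma_nat_add_half_le n
    _ = _ := mul_comm _ _

/-- `log y ≤ y - 1` is applied at `y = x` and at `y = x ^ (-1/2)`. The exponent `-1/2` keeps the
bound integrable at `0` even for the exponential law `n = 0`. -/
lemma abs_log_le_add_rpow_neg_half {x : ℝ} (hx : 0 < x) :
    |Real.log x| ≤ x + 2 * x ^ (-(1 / 2) : ℝ) := by
  have h0 : 0 < x ^ (-(1 / 2) : ℝ) := Real.rpow_pos_of_pos hx _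
  rw [abs_le]
  constructor
  · have := Real.log_le_sub_one_of_pos h0
    rw [Real.log_rpow hx] at this
    linarith
  · linarith [Real.log_le_sub_one_of_pos hx]

lemma ae_pos_erlang (n : ℕ) (r : ℝ) : ∀ᵐ x ∂erlang n r, 0 < x :=
  (withDensity_absolutelyContinuous _ _).ae_le (ae_restrict_mem measurableSet_Ioi)

lemma integrable_log_erlang (n : ℕ) {r : ℝ} (hr : 0 < r) :
    Integrable Real.log (erlang n r) := by
  refine ((integrable_id_erlang n hr).add
    ((integrable_rpow_neg_half_erlang n hr).const_mul 2)).mono'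
    Real.measurable_log.aestronglyMeasurable ?_
  filter_upwards [ae_pos_erlang n r] with x hx
  exact abs_log_le_add_rpow_neg_half hx

lemma integral_abs_log_erlang_le (n : ℕ) {r : ℝ} (hr : 0 < r) :
    ∫ x, |Real.log x| ∂erlang n r ≤ ((n : ℝ) + 1) / r + 4 * r ^ (1 / 2 : ℝ) := by
  have h1 := integrable_id_erlang n hr
  have h2 := (integrable_rpow_neg_half_erlang n hr).const_mul 2
  calc ∫ x, |Real.log x| ∂erlang n r
      ≤ ∫ x, (x + 2 * x ^ (-(1 / 2) : ℝ)) ∂erlang n r := by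
        refine integral_mono_ae (integrable_log_erlang n hr).abs (h1.add h2) ?_
        filter_upwards [ae_pos_erlang n r] with x hx
        exact abs_log_le_add_rpow_neg_half hx
    _ ≤ _ := by
        rw [integral_add h1 h2, integral_id_erlang n hr, integral_const_mul]
        linarith [integral_rpow_neg_half_erlang_le n hr]

/-- Differentiation of Euler's integral under the integral sign, transferred from the complex Gamma
function to the real line. -/
lemma hasDerivAt_Gamma_nat_add_one_integral (n : ℕ) :
    HasDerivAt Real.Gamma (∫ x in Ioi (0 : ℝ), x ^ n * Real.exp (-x) * Real.log x)
      ((n : ℝ) + 1) := by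
  have hs : 0 < (((n : ℝ) + 1 : ℝ) : ℂ).re := by
    rw [Complex.ofReal_re]; positivity
  have h := Complex.hasDerivAt_GammaIntegral hs
  have h2 : HasDerivAt Complex.Gamma
      ((∫ x in Ioi (0 : ℝ), x ^ n * Real.exp (-x) * Real.log x : ℝ) : ℂ)
      (((n : ℝ) + 1 : ℝ) : ℂ) := by
    rw [← integral_complex_ofReal]
    convert! h.congr_of_eventuallyEq (f₁ := Complex.Gamma) ?_ using 1
    · refine setIntegral_congr_fun measurableSet_Ioi fun x (hx : 0 < x) => ?_
      push_cast
      rw [add_sub_cancel_right, Complex.cpow_natCast]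
      ring
    · filter_upwards [(isOpen_lt continuous_const Complex.continuous_re).mem_nhds hs] with z hz
      exact Complex.Gamma_eq_integral hz
  exact h2.real_of_complex

lemma realDigamma_nat_add_one (n : ℕ) :
    realDigamma ((n : ℝ) + 1) = ∫ x, Real.log x ∂erlang n 1 := by
  have hpos : (0 : ℝ) < (n : ℝ) + 1 := by positivity
  have h := (hasDerivAt_Gamma_nat_add_one_integral n).log (Real.Gamma_pos_of_pos hpos).ne'
  rw [realDigamma, h.deriv, Real.Gamma_nat_eq_factorial, integral_erlang n one_pos,
    ← integral_div]
  refine integral_congr_ae (ae_of_all _ fun x => ?_)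
  simp only [erlangPDF, smul_eq_mul, one_pow, one_mul]
  ring

lemma integral_log_erlang (n : ℕ) {r : ℝ} (hr : 0 < r) :
    ∫ x, Real.log x ∂erlang n r = realDigamma ((n : ℝ) + 1) - Real.log r := by
  have hp := isProbabilityMeasure_erlang n one_pos
  have h1 : realDigamma ((n : ℝ) + 1) - Real.log r =
      ∫ x, (Real.log x - Real.log r) ∂erlang n 1 := by
    rw [realDigamma_nat_add_one, integral_sub (integrable_log_erlang n one_pos)
      (integrable_const _)]
    simp
  rw [h1, integral_erlang n hr, integral_erlang n one_pos]
  -- The substitution `y = r x` reduces rate `r` to rate 1, at the cost of `log r`.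
  have h2 := integral_comp_mul_left_Ioi
    (fun y => erlangPDF n 1 y • (Real.log y - Real.log r)) 0 hr
  rw [mul_zero, eq_inv_smul_iff₀ hr.ne', ← integral_smul] at h2
  rw [← h2]
  refine setIntegral_congr_fun measurableSet_Ioi fun x (hx : 0 < x) => ?_
  simp only [erlangPDF, smul_eq_mul, one_pow, one_mul]
  rw [Real.log_mul hr.ne' hx.ne', mul_pow]
  ring

end Erlang

/-! ### The standard complex Gaussian vector: unitary invariance and quadratic forms. -/

section Gaussian

instance isProbabilityMeasure_stdComplexGaussian : IsProbabilityMeasure stdComplexGaussian :=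
  Measure.isProbabilityMeasure_map (MeasurableEquiv.measurable _).aemeasurable

instance isProbabilityMeasure_stdComplexGaussianVec (N : ℕ) :
    IsProbabilityMeasure (stdComplexGaussianVec N) :=
  Measure.isProbabilityMeasure_map (by fun_prop)

lemma integral_stdComplexGaussian (f : ℂ → ℂ) :
    ∫ z, f z ∂stdComplexGaussian =
      ∫ p : ℝ × ℝ, f ⟨p.1, p.2⟩ ∂(gaussianReal 0 (1 / 2)).prod (gaussianReal 0 (1 / 2)) := by
  rw [stdComplexGaussian, integral_map_equiv]
  rfl

lemma charFun_stdComplexGaussian (t : ℂ) :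
    charFun stdComplexGaussian t = Complex.exp (-(‖t‖ ^ 2 / 4 : ℝ)) := by
  have h : ∀ p : ℝ × ℝ, Complex.exp ((inner ℝ (⟨p.1, p.2⟩ : ℂ) t : ℝ) * Complex.I) =
      Complex.exp (t.re * p.1 * Complex.I) * Complex.exp (t.im * p.2 * Complex.I) := by
    intro p
    rw [← Complex.exp_add, Complex.inner]
    congr 1
    simp only [Complex.mul_re, Complex.conj_re, Complex.conj_im]
    push_cast
    ring
  rw [charFun_apply, integral_stdComplexGaussian]
  simp_rw [h]
  rw [integral_prod_mul (fun x : ℝ => Complex.exp (t.re * x * Complex.I))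
    (fun x : ℝ => Complex.exp (t.im * x * Complex.I)), ← charFun_apply_real, ← charFun_apply_real,
    charFun_gaussianReal, charFun_gaussianReal, ← Complex.exp_add, Complex.sq_norm,
    Complex.normSq_apply]
  congr 1
  push_cast
  ring

lemma charFun_stdComplexGaussianVec (N : ℕ) (t : EuclideanSpace ℂ (Fin N)) :
    charFun (stdComplexGaussianVec N) t = Complex.exp (-(‖t‖ ^ 2 / 4 : ℝ)) := by
  rw [stdComplexGaussianVec, charFun_pi]
  simp_rw [charFun_stdComplexGaussian]
  rw [← Complex.exp_sum, EuclideanSpace.norm_sq_eq, Finset.sum_neg_distrib, Finset.sum_div]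
  push_cast
  rfl

/-- The circularly symmetric Gaussian law is invariant under unitary maps. -/
lemma stdComplexGaussianVec_map {N : ℕ}
    (e : EuclideanSpace ℂ (Fin N) ≃ₗᵢ[ℂ] EuclideanSpace ℂ (Fin N)) :
    (stdComplexGaussianVec N).map e = stdComplexGaussianVec N := by
  have he : Measurable e := e.continuous.measurable
  have := Measure.isProbabilityMeasure_map (μ := stdComplexGaussianVec N) he.aemeasurable
  -- `charFun` pairs through the real inner product, so the real isometry underlying `e` is the one
  -- to move across it.
  let e' : EuclideanSpace ℂ (Fin N) ≃ₗᵢ[ℝ] EuclideanSpace ℂ (Fin N) :=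
    { e.toLinearEquiv.restrictScalars ℝ with norm_map' := e.norm_map }
  refine Measure.ext_of_charFun (funext fun t => ?_)
  have h1 : charFun ((stdComplexGaussianVec N).map e) t =
      charFun (stdComplexGaussianVec N) (e'.symm t) := by
    rw [charFun_apply, charFun_apply, integral_map he.aemeasurable (by fun_prop)]
    refine integral_congr_ae (ae_of_all _ fun x => ?_)
    have : inner ℝ (e x) t = inner ℝ x (e'.symm t) := e'.inner_map_eq_flip x t
    simp only [this]
  rw [h1, charFun_stdComplexGaussianVec, charFun_stdComplexGaussianVec, e'.symm.norm_map]

lemma integral_cexp_mul_sq_gaussianReal {c : ℂ} (hc : c.re < 1) :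
    ∫ x : ℝ, Complex.exp (c * (x : ℂ) ^ 2) ∂gaussianReal 0 (1 / 2) =
      (((Real.sqrt Real.pi)⁻¹ : ℝ) : ℂ) * (Real.pi / (1 - c)) ^ (1 / 2 : ℂ) := by
  rw [integral_gaussianReal_eq_integral_smul (by norm_num),
    ← integral_gaussian_complex (b := 1 - c) (by simpa using hc), ← integral_const_mul]
  refine integral_congr_ae (ae_of_all _ fun x => ?_)
  have h1 : 2 * Real.pi * ((1 / 2 : NNReal) : ℝ) = Real.pi := by push_cast; ring
  have h2 : -(x - 0) ^ 2 / (2 * ((1 / 2 : NNReal) : ℝ)) = -x ^ 2 := by push_cast; ring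
  simp only [gaussianPDFReal, h1, h2, Complex.real_smul]
  push_cast
  rw [mul_assoc, ← Complex.exp_add]
  congr 2
  ring

/-- The real and imaginary parts contribute the same principal square root, so the product is its
square and no choice of branch remains. -/
lemma integral_cexp_mul_normSq_stdComplexGaussian {c : ℂ} (hc : c.re < 1) :
    ∫ z : ℂ, Complex.exp (c * ((‖z‖ ^ 2 : ℝ) : ℂ)) ∂stdComplexGaussian = (1 - c)⁻¹ := by
  have h : ∀ p : ℝ × ℝ, Complex.exp (c * ((‖(⟨p.1, p.2⟩ : ℂ)‖ ^ 2 : ℝ) : ℂ)) =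
      Complex.exp (c * (p.1 : ℂ) ^ 2) * Complex.exp (c * (p.2 : ℂ) ^ 2) := by
    intro p
    rw [← Complex.exp_add, Complex.sq_norm, Complex.normSq_apply]
    congr 1
    push_cast
    ring
  have hpi : (Real.pi : ℂ) ≠ 0 := by exact_mod_cast Real.pi_ne_zero
  rw [integral_stdComplexGaussian]
  simp_rw [h]
  rw [integral_prod_mul (fun x : ℝ => Complex.exp (c * (x : ℂ) ^ 2))
    (fun x : ℝ => Complex.exp (c * (x : ℂ) ^ 2)), integral_cexp_mul_sq_gaussianReal hc,
    mul_mul_mul_comm, ← Complex.ofReal_mul, ← mul_inv, Real.mul_self_sqrt Real.pi_pos.le,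
    ← pow_two, one_div, Complex.cpow_ofNat_inv_pow, Complex.ofReal_inv, div_eq_mul_inv,
    inv_mul_cancel_left₀ hpi]

lemma integral_cexp_sum_stdComplexGaussianVec {N : ℕ} (l : Fin N → ℝ) (t : ℝ) :
    ∫ g, Complex.exp (t * ((∑ i, l i * ‖g i‖ ^ 2 : ℝ) : ℂ) * Complex.I)
        ∂stdComplexGaussianVec N = ∏ i, (1 - (t * l i : ℂ) * Complex.I)⁻¹ := by
  rw [stdComplexGaussianVec, integral_map (by fun_prop) (by fun_prop)]
  have h : ∀ g : Fin N → ℂ,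
      Complex.exp (t * ((∑ i, l i * ‖(WithLp.toLp 2 g : EuclideanSpace ℂ (Fin N)) i‖ ^ 2 : ℝ) : ℂ)
        * Complex.I) =
      ∏ i, Complex.exp ((t * l i : ℂ) * Complex.I * ((‖g i‖ ^ 2 : ℝ) : ℂ)) := by
    intro g
    rw [← Complex.exp_sum, Complex.ofReal_sum, Finset.mul_sum, Finset.sum_mul]
    refine congrArg _ (Finset.sum_congr rfl fun i _ => ?_)
    push_cast
    ring
  simp_rw [h]
  rw [integral_fintype_prod_eq_prod
    (fun i (z : ℂ) => Complex.exp ((t * l i : ℂ) * Complex.I * ((‖z‖ ^ 2 : ℝ) : ℂ)))]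
  refine Finset.prod_congr rfl fun i _ => integral_cexp_mul_normSq_stdComplexGaussian ?_
  simp

end Gaussian

/-! ### Diagonalization of `‖h‖²` and its characteristic function. -/

section Spectral

variable {N : ℕ} {R : Matrix (Fin N) (Fin N) ℂ}

lemma Matrix.IsHermitian.repr_toEuclideanCLM (hR : R.IsHermitian) (g : EuclideanSpace ℂ (Fin N))
    (i : Fin N) :
    hR.eigenvectorBasis.repr (Matrix.toEuclideanCLM (𝕜 := ℂ) R g) i =
      hR.eigenvalues i * hR.eigenvectorBasis.repr g i := by
  have hsa : IsSelfAdjoint (Matrix.toEuclideanCLM (𝕜 := ℂ) R) :=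
    IsSelfAdjoint.map (show IsSelfAdjoint R from hR) _
  have heig : Matrix.toEuclideanCLM (𝕜 := ℂ) R (hR.eigenvectorBasis i) =
      (hR.eigenvalues i : ℂ) • hR.eigenvectorBasis i := by
    ext k
    have := congrFun (hR.mulVec_eigenvectorBasis i) k
    simpa using this
  rw [OrthonormalBasis.repr_apply_apply, OrthonormalBasis.repr_apply_apply,
    ← hsa.adjoint_eq, ContinuousLinearMap.adjoint_inner_right, heig, inner_smul_left,
    Complex.conj_ofReal]

/-- Self-adjointness of the root gives `‖√R g‖² = ⟪g, R g⟫`, which is then expanded in the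
eigenbasis of `R`; the root itself need not be diagonalized. -/
lemma Matrix.PosSemidef.norm_sqrt_sq (hR : R.PosSemidef) (g : EuclideanSpace ℂ (Fin N)) :
    ‖Matrix.toEuclideanCLM (𝕜 := ℂ) (CFC.sqrt R) g‖ ^ 2 =
      ∑ i, hR.isHermitian.eigenvalues i *
        ‖hR.isHermitian.eigenvectorBasis.repr g i‖ ^ 2 := by
  have hsa : IsSelfAdjoint (Matrix.toEuclideanCLM (𝕜 := ℂ) (CFC.sqrt R)) :=
    IsSelfAdjoint.map (CFC.sqrt_nonneg R).isSelfAdjoint _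
  have h1 : inner ℂ (Matrix.toEuclideanCLM (𝕜 := ℂ) (CFC.sqrt R) g)
      (Matrix.toEuclideanCLM (𝕜 := ℂ) (CFC.sqrt R) g) =
      inner ℂ g (Matrix.toEuclideanCLM (𝕜 := ℂ) R g) := by
    rw [← ContinuousLinearMap.adjoint_inner_right, hsa.adjoint_eq,
      ← ContinuousLinearMap.comp_apply, ← ContinuousLinearMap.mul_def, ← map_mul,
      CFC.sqrt_mul_sqrt_self _ hR.nonneg]
  rw [inner_self_eq_norm_sq_to_K,
    ← hR.isHermitian.eigenvectorBasis.repr.inner_map_map g, PiLp.inner_apply] at h1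
  have h2 : ((‖Matrix.toEuclideanCLM (𝕜 := ℂ) (CFC.sqrt R) g‖ ^ 2 : ℝ) : ℂ) =
      ((∑ i, hR.isHermitian.eigenvalues i *
        ‖hR.isHermitian.eigenvectorBasis.repr g i‖ ^ 2 : ℝ) : ℂ) := by
    push_cast
    refine Eq.trans h1 (Finset.sum_congr rfl fun i _ => ?_)
    rw [hR.isHermitian.repr_toEuclideanCLM, ← smul_eq_mul, inner_smul_right,
      inner_self_eq_norm_sq_to_K]
    rfl
  exact_mod_cast h2

lemma Matrix.PosSemidef.charFun_map_norm_sq_complexGaussian (hR : R.PosSemidef) (t : ℝ) :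
    charFun ((complexGaussian 0 R).map fun h => ‖h‖ ^ 2) t =
      ∏ i ∈ hR.PosIdx, (1 - (t * hR.isHermitian.eigenvalues i : ℂ) * Complex.I)⁻¹ := by
  -- Zero eigenvalues contribute the factor 1.
  have h0 : ∏ i ∈ hR.PosIdx, (1 - (t * hR.isHermitian.eigenvalues i : ℂ) * Complex.I)⁻¹ =
      ∏ i, (1 - (t * hR.isHermitian.eigenvalues i : ℂ) * Complex.I)⁻¹ := by
    refine Finset.prod_subset (Finset.subset_univ _) fun i _ hi => ?_
    have : hR.isHermitian.eigenvalues i = 0 :=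
      le_antisymm (by simpa [Matrix.PosSemidef.PosIdx] using hi) (hR.eigenvalues_nonneg i)
    simp [this]
  rw [h0, ← integral_cexp_sum_stdComplexGaussianVec,
    ← stdComplexGaussianVec_map hR.isHermitian.eigenvectorBasis.repr,
    integral_map (by fun_prop) (by fun_prop), charFun_apply_real,
    integral_map (by fun_prop) (by fun_prop), complexGaussian,
    integral_map (by fun_prop) (by fun_prop)]
  refine integral_congr_ae (ae_of_all _ fun g => ?_)
  simp only [zero_add, hR.norm_sqrt_sq]

end Spectral

/-! ### Countable mixtures of Gamma laws. -/

section Mixture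

/-- The mixture `∑ k, c k • erlang (m + k) r` of Gamma distributions of common rate `r`. -/
noncomputable def erlangMixture (c : ℕ → ℝ) (m : ℕ) (r : ℝ) : Measure ℝ :=
  Measure.sum fun k => ENNReal.ofReal (c k) • erlang (m + k) r

variable {c : ℕ → ℝ} {m : ℕ} {r : ℝ}

/-- Finiteness is enough for uniqueness of characteristic functions, so the weights need not be
shown to sum to 1. -/
lemma isFiniteMeasure_erlangMixture (hc : ∀ k, 0 ≤ c k) (hs : Summable c) (hr : 0 < r) :
    IsFiniteMeasure (erlangMixture c m r) := by
  constructor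
  have (k : ℕ) : erlang (m + k) r Set.univ = 1 :=
    (isProbabilityMeasure_erlang (m + k) hr).measure_univ
  rw [erlangMixture, Measure.sum_apply _ MeasurableSet.univ]
  simp only [Measure.smul_apply, this, smul_eq_mul, mul_one]
  rw [← ENNReal.ofReal_tsum_of_nonneg hc hs]
  exact ENNReal.ofReal_lt_top

lemma ae_pos_erlangMixture : ∀ᵐ x ∂erlangMixture c m r, 0 < x := by
  rw [erlangMixture, Measure.ae_sum_iff]
  exact fun k => Measure.ae_smul_measure (ae_pos_erlang _ _) _

lemma hasSum_integral_erlangMixture {E : Type*} [NormedAddCommGroup E] [NormedSpace ℝ E]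
    (hc : ∀ k, 0 ≤ c k) {f : ℝ → E} (hf : Integrable f (erlangMixture c m r)) :
    HasSum (fun k => c k • ∫ x, f x ∂erlang (m + k) r) (∫ x, f x ∂erlangMixture c m r) := by
  have := hasSum_integral_measure hf
  simp only [integral_smul_measure, ENNReal.toReal_ofReal (hc _)] at this
  exact this

lemma integrable_erlangMixture (hc : ∀ k, 0 ≤ c k) {f : ℝ → ℝ} {B : ℕ → ℝ}
    (hf : ∀ k, Integrable f (erlang (m + k) r)) (hB : ∀ k, ∫ x, |f x| ∂erlang (m + k) r ≤ B k)
    (hs : Summable fun k => c k * B k) : Integrable f (erlangMixture c m r) := by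
  refine integrable_sum_measure (fun k => (hf k).smul_measure ENNReal.ofReal_ne_top) ?_
  simp only [integral_smul_measure, ENNReal.toReal_ofReal (hc _), Real.norm_eq_abs, smul_eq_mul]
  exact hs.of_nonneg_of_le
    (fun k => mul_nonneg (hc k) (integral_nonneg fun _ => abs_nonneg _))
    (fun k => mul_le_mul_of_nonneg_left (hB k) (hc k))

lemma integrable_id_erlangMixture (hc : ∀ k, 0 ≤ c k) (hs : Summable c)
    (hs' : Summable fun k => c k * (k : ℝ)) (hr : 0 < r) :
    Integrable (fun x : ℝ => x) (erlangMixture c m r) := by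
  refine integrable_erlangMixture hc (B := fun k => (((m + k : ℕ) : ℝ) + 1) / r)
    (fun k => integrable_id_erlang _ hr) (fun k => ?_) ?_
  · rw [← integral_id_erlang _ hr]
    refine (integral_congr_ae ?_).le
    filter_upwards [ae_pos_erlang (m + k) r] with x hx using abs_of_pos hx
  · refine (((hs.mul_right ((m : ℝ) + 1)).add hs').div_const r).congr fun k => ?_
    push_cast
    ring

lemma integrable_log_erlangMixture (hc : ∀ k, 0 ≤ c k) (hs : Summable c)
    (hs' : Summable fun k => c k * (k : ℝ)) (hr : 0 < r) :
    Integrable Real.log (erlangMixture c m r) := by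
  refine integrable_erlangMixture hc (fun k => integrable_log_erlang _ hr)
    (fun k => integral_abs_log_erlang_le _ hr) ?_
  refine ((((hs.mul_right ((m : ℝ) + 1)).add hs').div_const r).add
    (hs.mul_right (4 * r ^ (1 / 2 : ℝ)))).congr fun k => ?_
  push_cast
  ring

lemma hasSum_integral_log_erlangMixture (hc : ∀ k, 0 ≤ c k) (hs : Summable c)
    (hs' : Summable fun k => c k * (k : ℝ)) (hr : 0 < r) :
    HasSum (fun k : ℕ => c k * (realDigamma (((m + k : ℕ) : ℝ) + 1) - Real.log r))
      (∫ x, Real.log x ∂erlangMixture c m r) := by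
  have := hasSum_integral_erlangMixture hc (integrable_log_erlangMixture (m := m) hc hs hs' hr)
  simpa only [integral_log_erlang _ hr, smul_eq_mul] using this

lemma hasSum_charFun_erlangMixture (hc : ∀ k, 0 ≤ c k) (hs : Summable c) (hr : 0 < r) (t : ℝ) :
    HasSum (fun k : ℕ => (c k : ℂ) * ((r : ℂ) / (r - t * Complex.I)) ^ (m + k + 1))
      (charFun (erlangMixture c m r) t) := by
  have := isFiniteMeasure_erlangMixture (m := m) hc hs hr
  have hi : Integrable (fun x : ℝ => Complex.exp (t * x * Complex.I)) (erlangMixture c m r) := by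
    refine (integrable_const (1 : ℝ)).mono' (by fun_prop) (ae_of_all _ fun x => ?_)
    rw [← Complex.ofReal_mul, Complex.norm_exp_ofReal_mul_I]
  have h := hasSum_integral_erlangMixture hc hi
  simp only [← charFun_apply_real, charFun_erlang _ hr, Complex.real_smul] at h
  exact h

end Mixture

/-! ### High-SNR expansion for a general positive gain `Y`. -/

section HighSNR

variable {Ω : Type*} [MeasurableSpace Ω] {P : Measure Ω} {Y : Ω → ℝ}

lemma integrable_log_one_add_mul (hY : Integrable Y P) (hpos : ∀ᵐ ω ∂P, 0 < Y ω) {p : ℝ}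
    (hp : 0 < p) : Integrable (fun ω => Real.logb 2 (1 + p * Y ω)) P := by
  have hi : Integrable (fun ω => Real.log (1 + p * Y ω)) P := by
    refine (hY.const_mul p).mono' (Real.measurable_log.comp_aemeasurable
      ((hY.aemeasurable.const_mul p).const_add 1)).aestronglyMeasurable ?_
    filter_upwards [hpos] with ω hω
    have h1 : 0 < p * Y ω := mul_pos hp hω
    rw [Real.norm_of_nonneg (Real.log_nonneg (by linarith))]
    linarith [Real.log_le_sub_one_of_pos (show 0 < 1 + p * Y ω by linarith)]
  exact hi.div_const _

lemma tendsto_integral_logb_one_add_mul_sub [IsProbabilityMeasure P] (hY : Integrable Y P)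
    (hlog : Integrable (fun ω => Real.log (Y ω)) P) (hpos : ∀ᵐ ω ∂P, 0 < Y ω) :
    Tendsto (fun p => ∫ ω, Real.logb 2 (1 + p * Y ω) ∂P -
      (Real.logb 2 p + ∫ ω, Real.logb 2 (Y ω) ∂P)) atTop (𝓝 0) := by
  have h1i : Integrable (fun ω => Real.logb 2 (1 + 1 * Y ω)) P :=
    integrable_log_one_add_mul hY hpos one_pos
  have hli : Integrable (fun ω => Real.logb 2 (Y ω)) P := hlog.div_const _
  have hformula : ∀ p : ℝ, 0 < p → ∀ y : ℝ, 0 < y →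
      Real.logb 2 (1 + p * y) - (Real.logb 2 p + Real.logb 2 y) = Real.logb 2 (1 + (p * y)⁻¹) := by
    intro p hp y hy
    have hpy := mul_pos hp hy
    rw [← Real.logb_mul hp.ne' hy.ne', ← Real.logb_div (by positivity) hpy.ne', add_div,
      div_self hpy.ne', add_comm, one_div]
  have hDCT : Tendsto (fun p => ∫ ω, (Real.logb 2 (1 + p * Y ω) -
      (Real.logb 2 p + Real.logb 2 (Y ω))) ∂P) atTop (𝓝 (∫ _, (0 : ℝ) ∂P)) := by
    refine tendsto_integral_filter_of_dominated_convergence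
      -- The dominating function is the integrand at `p = 1`: the family is nonnegative and
      -- decreasing in `p`.
      (fun ω => Real.logb 2 (1 + 1 * Y ω) - (Real.logb 2 1 + Real.logb 2 (Y ω))) ?_ ?_ ?_ ?_
    · filter_upwards [eventually_gt_atTop 0] with p hp
      exact ((integrable_log_one_add_mul hY hpos hp).sub
        ((integrable_const _).add hli)).aestronglyMeasurable
    · filter_upwards [eventually_ge_atTop 1] with p hp
      filter_upwards [hpos] with ω hω
      have hp0 : 0 < p := by linarith
      have h1 : (0 : ℝ) < (p * Y ω)⁻¹ := by positivity
      rw [hformula p hp0 _ hω, hformula 1 one_pos _ hω,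
        Real.norm_of_nonneg (Real.logb_nonneg one_lt_two (by linarith))]
      refine Real.logb_le_logb_of_le one_lt_two (by linarith) ?_
      gcongr
    · exact h1i.sub ((integrable_const _).add hli)
    · filter_upwards [hpos] with ω hω
      have h2 : Tendsto (fun p : ℝ => 1 + (p * Y ω)⁻¹) atTop (𝓝 (1 + 0)) :=
        (tendsto_inv_atTop_zero.comp (tendsto_id.atTop_mul_const hω)).const_add 1
      have h3 := ((Real.continuousAt_log (by norm_num : (1 : ℝ) + 0 ≠ 0)).tendsto.comp
        h2).div_const (Real.log 2)
      simp only [add_zero, Real.log_one, zero_div] at h3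
      refine h3.congr' ?_
      filter_upwards [eventually_gt_atTop 0] with p hp
      rw [hformula p hp _ hω]
      rfl
  rw [integral_zero] at hDCT
  refine hDCT.congr' ?_
  filter_upwards [eventually_gt_atTop 0] with p hp
  have h4 : Integrable (fun ω => Real.logb 2 p + Real.logb 2 (Y ω)) P :=
    (integrable_const _).add hli
  rw [integral_sub (integrable_log_one_add_mul hY hpos hp) h4,
    integral_add (integrable_const _) hli]
  simp

lemma hasHighSNRExpansion_integral_logb [IsProbabilityMeasure P] (hY : Integrable Y P)
    (hlog : Integrable (fun ω => Real.log (Y ω)) P) (hpos : ∀ᵐ ω ∂P, 0 < Y ω) :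
    HasHighSNRExpansion (fun p => ∫ ω, Real.logb 2 (1 + p * Y ω) ∂P) 1
      (-∫ ω, Real.logb 2 (Y ω) ∂P) := by
  have h := tendsto_integral_logb_one_add_mul_sub hY hlog hpos
  refine ⟨?_, by simpa only [one_mul, sub_neg_eq_add] using h⟩
  have hb : Tendsto (Real.logb 2) atTop atTop := Real.tendsto_logb_atTop one_lt_two
  -- The slope follows from the offset expansion: `C(p) - log₂ p` converges, so its quotient by
  -- `log₂ p` vanishes.
  have h1 := ((h.add_const (∫ ω, Real.logb 2 (Y ω) ∂P)).div_atTop hb).add_const 1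
  rw [zero_add] at h1
  refine h1.congr' ?_
  filter_upwards [hb.eventually_gt_atTop 0] with p hp
  field_simp
  ring

end HighSNR

/-! ### Positive eigenvalues, the coefficients `ψ_k`, and the law of `‖h‖²`. -/

namespace Matrix.PosSemidef

variable {N : ℕ} {R : Matrix (Fin N) (Fin N) ℂ}

lemma rank_eq_card_posIdx (hR : R.PosSemidef) : R.rank = hR.PosIdx.card := by
  rw [hR.isHermitian.rank_eq_card_non_zero_eigs, Fintype.card_subtype, PosIdx]
  congr 1
  ext i
  simp [(hR.eigenvalues_nonneg i).lt_iff_ne']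

lemma posIdx_nonempty (hR : R.PosSemidef) (hR0 : R ≠ 0) : hR.PosIdx.Nonempty := by
  by_contra he
  refine hR0 (hR.isHermitian.eigenvalues_eq_zero_iff.1 (funext fun i => ?_))
  refine le_antisymm (not_lt.1 fun hi => he ⟨i, ?_⟩) (hR.eigenvalues_nonneg i)
  simpa [PosIdx] using hi

lemma eigenvalues_pos_of_mem (hR : R.PosSemidef) {i : Fin N} (hi : i ∈ hR.PosIdx) :
    0 < hR.isHermitian.eigenvalues i := by
  simpa [PosIdx] using hi

lemma lambdaMin_le (hR : R.PosSemidef) {i : Fin N} (hi : i ∈ hR.PosIdx) :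
    hR.lambdaMin ≤ hR.isHermitian.eigenvalues i :=
  ciInf_le (Set.finite_range _).bddBelow (⟨i, hi⟩ : hR.PosIdx)

lemma lambdaMin_pos (hR : R.PosSemidef) (hR0 : R ≠ 0) : 0 < hR.lambdaMin := by
  have : Nonempty hR.PosIdx := (hR.posIdx_nonempty hR0).to_subtype
  obtain ⟨i, hi⟩ := exists_eq_ciInf_of_finite
    (f := fun i : hR.PosIdx => hR.isHermitian.eigenvalues i)
  rw [lambdaMin, ← hi]
  exact hR.eigenvalues_pos_of_mem i.2

lemma posEigProd_pos (hR : R.PosSemidef) : 0 < hR.posEigProd :=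
  Finset.prod_pos fun _ hi => hR.eigenvalues_pos_of_mem hi

lemma one_sub_div_mem (hR : R.PosSemidef) (hR0 : R ≠ 0) :
    ∀ j ∈ hR.PosIdx, 0 ≤ 1 - hR.lambdaMin / hR.isHermitian.eigenvalues j ∧
      1 - hR.lambdaMin / hR.isHermitian.eigenvalues j < 1 := by
  intro j hj
  have h1 := hR.eigenvalues_pos_of_mem hj
  have h2 : hR.lambdaMin / hR.isHermitian.eigenvalues j ≤ 1 :=
    (div_le_one h1).2 (hR.lambdaMin_le hj)
  have h3 : 0 < hR.lambdaMin / hR.isHermitian.eigenvalues j := div_pos (hR.lambdaMin_pos hR0) h1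
  constructor <;> linarith

lemma gainCoeff_nonneg (hR : R.PosSemidef) (hR0 : R ≠ 0) (k : ℕ) : 0 ≤ hR.gainCoeff k := by
  rw [hR.gainCoeff_eq_coeff]
  exact coeff_geomProd_nonneg _ _ (fun j hj => (hR.one_sub_div_mem hR0 j hj).1) k

lemma summable_gainCoeff (hR : R.PosSemidef) (hR0 : R ≠ 0) : Summable hR.gainCoeff :=
  (summable_coeff_geomProd _ _ (hR.one_sub_div_mem hR0)).congr fun k =>
    (hR.gainCoeff_eq_coeff k).symm

lemma summable_gainCoeff_mul_nat (hR : R.PosSemidef) (hR0 : R ≠ 0) :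
    Summable fun k : ℕ => hR.gainCoeff k * (k : ℝ) :=
  (summable_coeff_geomProd_mul_nat _ _ (hR.one_sub_div_mem hR0)).congr fun k => by
    rw [hR.gainCoeff_eq_coeff]

lemma hasSum_gainCoeff_mul_pow (hR : R.PosSemidef) (hR0 : R ≠ 0) {z : ℂ} (hz : ‖z‖ ≤ 1) :
    HasSum (fun k : ℕ => (hR.gainCoeff k : ℂ) * z ^ k)
      (∏ j ∈ hR.PosIdx,
        (1 - ((1 - hR.lambdaMin / hR.isHermitian.eigenvalues j : ℝ) : ℂ) * z)⁻¹) := by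
  simp only [hR.gainCoeff_eq_coeff]
  refine (summable_norm_and_hasSum_geomProd _ _ z fun j hj => ?_).2
  obtain ⟨h1, h2⟩ := hR.one_sub_div_mem hR0 j hj
  rw [norm_mul, Complex.norm_real, Real.norm_of_nonneg h1]
  exact (mul_le_of_le_one_right h1 hz).trans_lt h2

/-- The Moschopoulos expansion of the law of the channel gain as a mixture of Gamma laws. -/
theorem map_norm_sq_complexGaussian (hR : R.PosSemidef) (hR0 : R ≠ 0) {m : ℕ}
    (hm : R.rank = m + 1) :
    (complexGaussian 0 R).map (fun h => ‖h‖ ^ 2) =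
      erlangMixture (fun k => hR.lambdaMin ^ R.rank / hR.posEigProd * hR.gainCoeff k) m
        hR.lambdaMin⁻¹ := by
  have hβ := hR.lambdaMin_pos hR0
  have hC : 0 < hR.lambdaMin ^ R.rank / hR.posEigProd := div_pos (pow_pos hβ _) hR.posEigProd_pos
  have hc : ∀ k, 0 ≤ hR.lambdaMin ^ R.rank / hR.posEigProd * hR.gainCoeff k :=
    fun k => mul_nonneg hC.le (hR.gainCoeff_nonneg hR0 k)
  have hs := (hR.summable_gainCoeff hR0).mul_left (hR.lambdaMin ^ R.rank / hR.posEigProd)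
  have := isFiniteMeasure_erlangMixture (m := m) hc hs (inv_pos.2 hβ)
  have hfin : IsFiniteMeasure (complexGaussian 0 R) := by
    rw [complexGaussian]; infer_instance
  refine Measure.ext_of_charFun (funext fun t => ?_)
  rw [hR.charFun_map_norm_sq_complexGaussian]
  -- Both characteristic functions are identified as sums of one and the same series in `z`.
  refine HasSum.unique ?_ (hasSum_charFun_erlangMixture hc hs (inv_pos.2 hβ) t)
  set β := hR.lambdaMin with hβdef
  have hβ0 : (β : ℂ) ≠ 0 := by exact_mod_cast hβ.ne'
  have hne : ∀ x : ℝ, (1 : ℂ) - x * Complex.I ≠ 0 := fun x h => by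
    have := congrArg Complex.re h
    simp at this
  have hz : ((β⁻¹ : ℝ) : ℂ) / ((β⁻¹ : ℝ) - t * Complex.I) = (1 - (t * β : ℝ) * Complex.I)⁻¹ := by
    push_cast
    rw [← mul_div_mul_left _ _ hβ0, mul_inv_cancel₀ hβ0, mul_sub, mul_inv_cancel₀ hβ0, one_div]
    congr 2
    ring
  rw [hz]
  set z : ℂ := (1 - (t * β : ℝ) * Complex.I)⁻¹ with hzdef
  have hz1 : ‖z‖ ≤ 1 := by
    rw [hzdef, norm_inv]
    refine inv_le_one_of_one_le₀ ?_
    have := Complex.abs_re_le_norm (1 - (t * β : ℝ) * Complex.I)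
    simpa using this
  have hprod : ∏ i ∈ hR.PosIdx, (1 - (t * hR.isHermitian.eigenvalues i : ℂ) * Complex.I)⁻¹ =
      (((β ^ R.rank / hR.posEigProd : ℝ) : ℂ) * z ^ (m + 1)) * ∏ j ∈ hR.PosIdx,
        (1 - ((1 - β / hR.isHermitian.eigenvalues j : ℝ) : ℂ) * z)⁻¹ := by
    have hcz : ((β ^ R.rank / hR.posEigProd : ℝ) : ℂ) * z ^ (m + 1) =
        ∏ j ∈ hR.PosIdx, (((β / hR.isHermitian.eigenvalues j : ℝ) : ℂ) * z) := by
      rw [Finset.prod_mul_distrib, Finset.prod_const, ← hR.rank_eq_card_posIdx, hm,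
        ← Complex.ofReal_prod, Finset.prod_div_distrib, Finset.prod_const,
        ← hR.rank_eq_card_posIdx, hm, posEigProd]
    rw [hcz, ← Finset.prod_mul_distrib]
    refine Finset.prod_congr rfl fun j hj => ?_
    have hl0 : (hR.isHermitian.eigenvalues j : ℂ) ≠ 0 := by
      exact_mod_cast (hR.eigenvalues_pos_of_mem hj).ne'
    have hw := hne (t * β)
    have hl := hne (t * hR.isHermitian.eigenvalues j)
    -- Divided by `z`, this reads `(1 - i t β) - 1 + β/λ_j = (β/λ_j)(1 - i t λ_j)`.
    have h1 : 1 - ((1 - β / hR.isHermitian.eigenvalues j : ℝ) : ℂ) * z =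
        (((β / hR.isHermitian.eigenvalues j : ℝ) : ℂ) * z) *
          (1 - (t * hR.isHermitian.eigenvalues j : ℂ) * Complex.I) := by
      have hzw : z * (1 - (t * β : ℝ) * Complex.I) = 1 := inv_mul_cancel₀ hw
      push_cast at hzw ⊢
      field_simp
      linear_combination (-(hR.isHermitian.eigenvalues j : ℂ)) * hzw
    have h2 : ((β / hR.isHermitian.eigenvalues j : ℝ) : ℂ) * z ≠ 0 := by
      refine mul_ne_zero ?_ (inv_ne_zero hw)
      push_cast
      exact div_ne_zero hβ0 hl0
    rw [h1, mul_inv, mul_inv_cancel_left₀ h2]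
  rw [hprod]
  convert! (hR.hasSum_gainCoeff_mul_pow hR0 hz1).mul_left
    (((β ^ R.rank / hR.posEigProd : ℝ) : ℂ) * z ^ (m + 1)) using 1
  funext k
  push_cast
  ring

end Matrix.PosSemidef

/-! ### The capacity expansion. -/

theorem mainTheorem7 {N : ℕ} (R : Matrix (Fin N) (Fin N) ℂ) (hR : R.PosSemidef) (hR0 : R ≠ 0)
    (σ : ℝ) (hσ : 0 < σ)
    {Ω : Type*} [MeasurableSpace Ω] (P : Measure Ω) [IsProbabilityMeasure P]
    (h : Ω → EuclideanSpace ℂ (Fin N)) (hh : HasLaw h (complexGaussian 0 R) P) :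
    (∀ p : ℝ, 0 < p → Integrable (fun ω => Real.logb 2 (1 + receivedSNR σ p (h ω))) P) ∧
    Integrable (fun ω => Real.logb 2 (‖h ω‖ ^ 2 / σ ^ 2)) P ∧
    Summable (fun k : ℕ => hR.gainCoeff k *
      (realDigamma ((R.rank : ℝ) + k) + Real.log hR.lambdaMin) / Real.log 2) ∧
    ∃ S L : ℝ, HasHighSNRExpansion (ergodicCapacity P h σ) S L ∧
      S = 1 ∧
      L = -∫ ω, Real.logb 2 (‖h ω‖ ^ 2 / σ ^ 2) ∂P ∧
      L = Real.logb 2 (σ ^ 2) - hR.lambdaMin ^ R.rank / hR.posEigProd *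
        ∑' k : ℕ, hR.gainCoeff k *
          (realDigamma ((R.rank : ℝ) + k) + Real.log hR.lambdaMin) / Real.log 2 := by
  -- `erlang (m + k)` has shape `m + k + 1`, which is `rank + k`.
  obtain ⟨m, hm⟩ : ∃ m, R.rank = m + 1 := by
    refine Nat.exists_eq_succ_of_ne_zero ?_
    rw [hR.rank_eq_card_posIdx]
    exact (hR.posIdx_nonempty hR0).card_ne_zero
  have hβ := hR.lambdaMin_pos hR0
  set C : ℝ := hR.lambdaMin ^ R.rank / hR.posEigProd with hCdef
  have hC : 0 < C := div_pos (pow_pos hβ _) hR.posEigProd_pos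
  have hc : ∀ k, 0 ≤ C * hR.gainCoeff k := fun k => mul_nonneg hC.le (hR.gainCoeff_nonneg hR0 k)
  have hs := (hR.summable_gainCoeff hR0).mul_left C
  have hs' : Summable fun k : ℕ => C * hR.gainCoeff k * (k : ℝ) := by
    simpa only [mul_assoc] using (hR.summable_gainCoeff_mul_nat hR0).mul_left C
  have hβi : 0 < hR.lambdaMin⁻¹ := inv_pos.2 hβ
  have hlaw : HasLaw (fun ω => ‖h ω‖ ^ 2)
      (erlangMixture (fun k => C * hR.gainCoeff k) m hR.lambdaMin⁻¹) P := by
    refine ⟨by have := hh.aemeasurable; fun_prop, ?_⟩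
    rw [← hR.map_norm_sq_complexGaussian hR0 hm, ← hh.map_eq,
      AEMeasurable.map_map_of_aemeasurable (by fun_prop) hh.aemeasurable]
    rfl
  have hX : Integrable (fun ω => ‖h ω‖ ^ 2) P :=
    (hlaw.map_eq ▸ integrable_id_erlangMixture hc hs hs' hβi :
      Integrable (fun x : ℝ => x) (P.map fun ω => ‖h ω‖ ^ 2)).comp_aemeasurable hlaw.aemeasurable
  have hlogX : Integrable (fun ω => Real.log (‖h ω‖ ^ 2)) P :=
    (hlaw.map_eq ▸ integrable_log_erlangMixture hc hs hs' hβi :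
      Integrable Real.log (P.map fun ω => ‖h ω‖ ^ 2)).comp_aemeasurable hlaw.aemeasurable
  have hpos : ∀ᵐ ω ∂P, 0 < ‖h ω‖ ^ 2 :=
    ae_of_ae_map hlaw.aemeasurable (hlaw.map_eq.symm ▸ ae_pos_erlangMixture)
  have hElog : ∫ ω, Real.log (‖h ω‖ ^ 2) ∂P =
      ∫ x, Real.log x ∂erlangMixture (fun k => C * hR.gainCoeff k) m hR.lambdaMin⁻¹ := by
    rw [← hlaw.map_eq, integral_map hlaw.aemeasurable Real.measurable_log.aestronglyMeasurable]
  have hY : Integrable (fun ω => ‖h ω‖ ^ 2 / σ ^ 2) P := hX.div_const _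
  have hYpos : ∀ᵐ ω ∂P, 0 < ‖h ω‖ ^ 2 / σ ^ 2 := by
    filter_upwards [hpos] with ω hω using div_pos hω (pow_pos hσ 2)
  have hlogeq : (fun ω => Real.log (‖h ω‖ ^ 2 / σ ^ 2)) =ᵐ[P]
      fun ω => Real.log (‖h ω‖ ^ 2) - Real.log (σ ^ 2) := by
    filter_upwards [hpos] with ω hω using Real.log_div hω.ne' (pow_pos hσ 2).ne'
  have hlogY : Integrable (fun ω => Real.log (‖h ω‖ ^ 2 / σ ^ 2)) P :=
    (hlogX.sub (integrable_const _)).congr hlogeq.symm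
  have hsnr : ∀ p ω, receivedSNR σ p (h ω) = p * (‖h ω‖ ^ 2 / σ ^ 2) := fun p ω => by
    rw [receivedSNR]; ring
  -- The mixture weights carry the factor `C` and the series does not, hence the division by `C *
  -- log 2`. The rate `λ_min⁻¹` turns `-log r` into `+ log λ_min`.
  have hsum : HasSum (fun k : ℕ => hR.gainCoeff k *
      (realDigamma ((R.rank : ℝ) + k) + Real.log hR.lambdaMin) / Real.log 2)
      ((∫ ω, Real.log (‖h ω‖ ^ 2) ∂P) / (C * Real.log 2)) := by
    rw [hElog]
    convert! (hasSum_integral_log_erlangMixture (m := m) hc hs hs' hβi).div_const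
      (C * Real.log 2) using 1
    funext k
    rw [Real.log_inv, sub_neg_eq_add, mul_assoc, mul_div_mul_left _ _ hC.ne', hm]
    push_cast
    rw [add_right_comm]
  refine ⟨fun p hp => ?_, hlogY.div_const _, hsum.summable, 1,
    -∫ ω, Real.logb 2 (‖h ω‖ ^ 2 / σ ^ 2) ∂P, ?_, rfl, rfl, ?_⟩
  · simp only [hsnr]
    exact integrable_log_one_add_mul hY hYpos hp
  · have := hasHighSNRExpansion_integral_logb hY hlogY hYpos
    simp only [← hsnr] at this
    exact this
  · have hl2 : Real.log 2 ≠ 0 := (Real.log_pos one_lt_two).ne'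
    rw [hsum.tsum_eq]
    simp only [Real.logb]
    rw [integral_div, integral_congr_ae hlogeq, integral_sub hlogX (integrable_const _)]
    simp only [integral_const, probReal_univ, smul_eq_mul, one_mul]
    field_simp
    ring
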